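/- Consider the piecewise polynomial system $$(\dot x,\dot y)=\begin{cases}(-y+\varepsilon p^+(x,y),\;1-x+\varepsilon q^+(x,y)), & x\ge 0,\\ (-y+\varepsilon p^-(x,y),\;x+\varepsilon q^-(x,y)), & x<0,\end{cases}$$ where $p^\pm,q^\pm\in\mathbb R[x,y]$ are polynomials of degree at most $n$. For $0<h<1$ put $A=(0,-\sqrt{1-h})$ and $A_1=(0,\sqrt{1-h})$, let $L_h^+$ be the arc $x=1-\sqrt{h+y^2}$, $|y|\le\sqrt{1-h}$, of the curve $(x-1)^2-y^2=h$, oriented from $A$ to $A_1$, and let $L_h^-$ be the half circle $x^2+y^2=1-h$, $x\le 0$, oriented from $A_1$ to $A$; together they form a periodic orbit of the system with $\varepsilon=0$. The first order Melnikov function is $$\bar M(h)=\int_{L_h^+}q^+\,dx-p^+\,dy+\int_{L_h^-}q^-\,dx-p^-\,dy,\qquad 0<h<1.$$ Let $Z(n)$ be the maximal number of zeros of $\bar M$ in the open interval $(0,1)$, taken over all $p^\pm,q^\pm$ of degree at most $n$ for which $\bar M$ is not identically zero on $(0,1)$. Then, for every $n\ge 5$, $$n+\Big[\frac{n+1}{2}\Big]\;\le\;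 Z(n)\;\le\; 2n+\Big[\frac{n+1}{2}\Big],$$ where $[\cdot]$ denotes the integer part. Both bounds hold when $Z(n)$ counts distinct zeros, and also when it counts zeros with multiplicity. -/

import Mathlib

open MvPolynomial

noncomputable section

namespace PiecewiseMelnikov

/-- The value at `(x, y)` of a real polynomial in two variables. -/
def evalAt (f : MvPolynomial (Fin 2) ℝ) (x y : ℝ) : ℝ := eval ![x, y] f

/-- The line integral `∫ q dx - p dy` along the parametrized curve `t ↦ (x t, y t)`,
with `t` running from `a` to `b`. -/
def lineIntegral (p q : MvPolynomial (Fin 2) ℝ) (x y : ℝ → ℝ) (a b : ℝ) : ℝ :=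
  ∫ t in a..b, (evalAt q (x t) (y t) * deriv x t - evalAt p (x t) (y t) * deriv y t)

/-- A perturbation of the piecewise system: real polynomials `p⁺, q⁺` (used for `x ≥ 0`) and
`p⁻, q⁻` (used for `x < 0`). -/
structure Perturbation where
  pPlus : MvPolynomial (Fin 2) ℝ
  qPlus : MvPolynomial (Fin 2) ℝ
  pMinus : MvPolynomial (Fin 2) ℝ
  qMinus : MvPolynomial (Fin 2) ℝ

/-- All four polynomials have total degree at most `n`. -/
def Perturbation.DegreeLE (P : Perturbation) (n : ℕ) : Prop :=
  P.pPlus.totalDegree ≤ n ∧ P.qPlus.totalDegree ≤ n ∧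
    P.pMinus.totalDegree ≤ n ∧ P.qMinus.totalDegree ≤ n

/-- `∫ q⁺ dx - p⁺ dy` over the right part of the periodic orbit, i.e. the arc of the level curve
`((x - 1)² - y²) / 2 = h / 2`, `x ≥ 0`, that joins `(0, -√(1 - h))` to `(0, √(1 - h))`. It is the
graph `x = 1 - √(h + y²)`, and `y` serves as the parameter. -/
def melnikovPlus (P : Perturbation) (h : ℝ) : ℝ :=
  lineIntegral P.pPlus P.qPlus (fun y => 1 - √(h + y ^ 2)) (fun y => y) (-√(1 - h)) (√(1 - h))

/-- `∫ q⁻ dx - p⁻ dy` over the left part of the periodic orbit, i.e. the half circle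
`-(x² + y²) / 2 = (h - 1) / 2`, `x ≤ 0`, traversed from `(0, √(1 - h))` to `(0, -√(1 - h))`. -/
def melnikovMinus (P : Perturbation) (h : ℝ) : ℝ :=
  lineIntegral P.pMinus P.qMinus (fun θ => √(1 - h) * Real.cos θ) (fun θ => √(1 - h) * Real.sin θ)
    (Real.pi / 2) (3 * Real.pi / 2)

/-- The first order Melnikov function `h ↦ M̄(h)`, for `0 < h < 1`. -/
def melnikov (P : Perturbation) (h : ℝ) : ℝ := melnikovPlus P h + melnikovMinus P h

/-- The perturbations of degree at most `n` whose Melnikov function does not vanish identically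
on `(0, 1)`. -/
def admissible (n : ℕ) : Set Perturbation :=
  {P | P.DegreeLE n ∧ ∃ h ∈ Set.Ioo (0 : ℝ) 1, melnikov P h ≠ 0}

/-- The number of zeros of `f` on `(0, 1)`, each zero counted once. -/
def numZeros (f : ℝ → ℝ) : ℕ∞ := {h ∈ Set.Ioo (0 : ℝ) 1 | f h = 0}.encard

/-- The number of zeros of `f` on `(0, 1)`, each zero counted as often as its order indicates. -/
def numZerosMult (f : ℝ → ℝ) : ℕ∞ :=
  ⨆ (S : Finset ℝ) (_ : (S : Set ℝ) ⊆ Set.Ioo 0 1), ∑ h ∈ S, analyticOrderAt f h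

/-- The maximal number of distinct zeros on `(0, 1)` of a Melnikov function that is not
identically zero. -/
def Z (n : ℕ) : ℕ∞ := ⨆ P ∈ admissible n, numZeros (melnikov P)

/-- The maximal number of zeros on `(0, 1)`, counted with multiplicity, of a Melnikov function
that is not identically zero. -/
def ZMult (n : ℕ) : ℕ∞ := ⨆ P ∈ admissible n, numZerosMult (melnikov P)

end PiecewiseMelnikov

end

noncomputable section

namespace PiecewiseMelnikov

open Set Filter Topology

/-! ### Zeros counted with multiplicity -/

/-! With `s = √(1 - h)` and `L s = log ((1 + s) / (1 - s))`, every Melnikov function becomes `F s =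
s Q(s) + C(1 - s²) L s`, where `deg Q ≤ n`, `deg C ≤ [(n+1)/2]` and `C(0) = 0`. The half circle
contributes powers of `s` by scaling. On the hyperbolic arc, `u = 1 - x` satisfies `u² = 1 - s² +
y²`, and integration by parts reduces all moments to `s` and `(1 - s²) L`
(`melnikov_mem_melnikovSpace`).

Upper bound: put `G s = C(1 - s²)`, divisible by `1 - s²`. In the Wronskian `W = F' G - F G'` the
logarithm cancels, and since `L' = 2 / (1 - s²)`, `W` is a polynomial. It is nonzero when `C ≠ 0`,
because `L` is not rational. Rolle's theorem for `F / G` between zeros of `G` bounds the zeros of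
`F` on `[0, 1)`, with multiplicity, by `deg W + #{zeros of G} + 1`
(`sum_analyticOrderAt_le_of_wronskian`). One of them is `s = 0`, which does not count.

Lower bound: `p⁻ = x^d` with `d ≤ n` and `p⁺ = (1 - x)^(2m+1)` with `2m + 1 ≤ n` give `n + 1 +
[(n+1)/2]` linearly independent functions, so a nontrivial combination vanishes at any prescribed `n
+ [(n+1)/2]` points. -/

theorem analyticAt_polynomial_eval (p : Polynomial ℝ) (z : ℝ) :
    AnalyticAt ℝ (fun x => p.eval x) z := by
  simpa using AnalyticAt.aeval_polynomial (analyticAt_id (𝕜 := ℝ) (z := z)) p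

theorem analyticOrderAt_polynomial_eval {p : Polynomial ℝ} (hp : p ≠ 0) (z : ℝ) :
    analyticOrderAt (fun x => p.eval x) z = p.rootMultiplicity z := by
  obtain ⟨q, hq, hdvd⟩ := Polynomial.exists_eq_pow_rootMultiplicity_mul_and_not_dvd p hp z
  rw [(analyticAt_polynomial_eval p z).analyticOrderAt_eq_natCast]
  refine ⟨fun x => q.eval x, analyticAt_polynomial_eval q z, ?_, Eventually.of_forall fun x => ?_⟩
  · rwa [Polynomial.dvd_iff_isRoot] at hdvd
  · conv_lhs => rw [hq]
    simp

theorem sum_rootMultiplicity_le_natDegree (p : Polynomial ℝ) (S : Finset ℝ) :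
    ∑ z ∈ S, p.rootMultiplicity z ≤ p.natDegree := by
  classical
  simp_rw [← Polynomial.count_roots]
  refine le_trans ?_ p.card_roots'
  rw [← Multiset.toFinset_sum_count_eq]
  refine Finset.sum_le_sum_of_ne_zero fun z _ hz => ?_
  exact Multiset.mem_toFinset.2 (Multiset.count_ne_zero.1 hz)

/-- A zero of `F` is a zero of the Wronskian `F' G - F G'`, of order at least one less. -/
theorem analyticOrderAt_le_wronskian_add_one {F G : ℝ → ℝ} {z : ℝ} (hF : AnalyticAt ℝ F z)
    (hG : AnalyticAt ℝ G z) :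
    analyticOrderAt F z ≤ analyticOrderAt (deriv F * G - F * deriv G) z + 1 := by
  by_cases h0 : F z = 0
  · have h1 : analyticOrderAt F z = analyticOrderAt (deriv F) z + 1 := by
      rw [hF.analyticOrderAt_deriv_add_one]; simp [h0]
    have h2 := le_analyticOrderAt_sub (f := deriv F * G) (g := F * deriv G) (z₀ := z)
    rw [analyticOrderAt_mul hF.deriv hG, analyticOrderAt_mul hF hG.deriv] at h2
    refine le_trans ?_ (add_le_add_left h2 1)
    rw [min_add, le_min_iff]
    constructor
    · rw [h1]; gcongr; exact le_self_add
    · rw [add_assoc]; exact le_self_add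
  · rw [hF.analyticOrderAt_eq_zero.2 h0]; exact zero_le

/-- A zero of `G` makes up for the order lost in `F'`, so the extra `1` is not needed. -/
theorem analyticOrderAt_le_wronskian {F G : ℝ → ℝ} {z : ℝ} (hF : AnalyticAt ℝ F z)
    (hG : AnalyticAt ℝ G z) (hGz : G z = 0) :
    analyticOrderAt F z ≤ analyticOrderAt (deriv F * G - F * deriv G) z := by
  by_cases h0 : F z = 0
  · have h1 : analyticOrderAt F z = analyticOrderAt (deriv F) z + 1 := by
      rw [hF.analyticOrderAt_deriv_add_one]; simp [h0]
    have hg : 1 ≤ analyticOrderAt G z :=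
      Order.one_le_iff_ne_zero.2 (hG.analyticOrderAt_ne_zero.2 hGz)
    have h2 := le_analyticOrderAt_sub (f := deriv F * G) (g := F * deriv G) (z₀ := z)
    rw [analyticOrderAt_mul hF.deriv hG, analyticOrderAt_mul hF hG.deriv] at h2
    refine le_trans ?_ h2
    rw [le_min_iff]
    constructor
    · rw [h1]; gcongr
    · exact le_self_add
  · rw [hF.analyticOrderAt_eq_zero.2 h0]; exact zero_le

/-- Rolle's theorem for the quotient `F / G`. -/
theorem exists_wronskian_eq_zero {F G : ℝ → ℝ} {x y : ℝ} (hxy : x < y)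
    (hF : ∀ z ∈ Icc x y, DifferentiableAt ℝ F z) (hG : ∀ z ∈ Icc x y, DifferentiableAt ℝ G z)
    (hG0 : ∀ z ∈ Icc x y, G z ≠ 0) (hx : F x = 0) (hy : F y = 0) :
    ∃ z ∈ Ioo x y, deriv F z * G z - F z * deriv G z = 0 := by
  obtain ⟨z, hz, hd⟩ := exists_deriv_eq_zero (f := fun t => F t / G t) hxy
    (fun t ht => ((hF t ht).continuousAt.div (hG t ht).continuousAt
      (hG0 t ht)).continuousWithinAt) (by simp [hx, hy])
  have hz' := Ioo_subset_Icc_self hz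
  refine ⟨z, hz, ?_⟩
  rw [deriv_fun_div (hF z hz') (hG z hz') (hG0 z hz'), div_eq_zero_iff] at hd
  exact hd.resolve_right (pow_ne_zero 2 (hG0 z hz'))

/-- If the Wronskian of `F` and `G` is a polynomial, the number of zeros of `F` is controlled by
the degree of this polynomial and the number of distinct zeros of `G`. -/
theorem sum_analyticOrderAt_le_of_wronskian {F G : ℝ → ℝ} {W : Polynomial ℝ} {I U : Set ℝ}
    (hW : W ≠ 0) (hI : I.OrdConnected) (hU : IsOpen U) (hIU : I ⊆ U)
    (hF : ∀ z ∈ U, AnalyticAt ℝ F z) (hG : ∀ z ∈ U, AnalyticAt ℝ G z)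
    (hWr : ∀ z ∈ U, deriv F z * G z - F z * deriv G z = W.eval z)
    {T : Finset ℝ} (hT : ∀ z ∈ I, G z = 0 → z ∈ T) {S : Finset ℝ} (hS : (S : Set ℝ) ⊆ I) :
    ∑ z ∈ S, analyticOrderAt F z ≤ (W.natDegree + T.card + 1 : ℕ) := by
  classical
  have hord : ∀ z ∈ U, analyticOrderAt (deriv F * G - F * deriv G) z = W.rootMultiplicity z := by
    intro z hz
    rw [← analyticOrderAt_polynomial_eval hW]
    exact analyticOrderAt_congr ((hU.eventually_mem hz).mono fun x hx => hWr x hx)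
  wlog hS0 : ∀ z ∈ S, F z = 0 generalizing S
  · rw [← Finset.sum_filter_of_ne (p := fun z => F z = 0)
      fun z _ h => apply_eq_zero_of_analyticOrderAt_ne_zero h]
    exact this (fun z hz => hS (Finset.mem_of_mem_filter z hz)) fun z hz => (Finset.mem_filter.1 hz).2
  -- Only these zeros of `F` can have order one more than that of `W`; their number is bounded by
  -- Rolle's theorem.
  set S₀ : Finset ℝ := {z ∈ S | G z ≠ 0} with hS₀
  have hle : ∀ z ∈ S, analyticOrderAt F z ≤
      ((W.rootMultiplicity z + if z ∈ S₀ then 1 else 0 : ℕ) : ℕ∞) := by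
    intro z hz
    have hzU := hIU (hS hz)
    by_cases hg : G z = 0
    · have := analyticOrderAt_le_wronskian (hF z hzU) (hG z hzU) hg
      rw [hord z hzU] at this
      exact this.trans (by exact_mod_cast Nat.le_add_right _ _)
    · have := analyticOrderAt_le_wronskian_add_one (hF z hzU) (hG z hzU)
      rw [hord z hzU] at this
      rw [if_pos (by simp [hS₀, hz, hg])]
      exact_mod_cast this
  refine (Finset.sum_le_sum hle).trans ?_
  rw [← Nat.cast_sum, Nat.cast_le, Finset.sum_add_distrib]
  have hcard : ∑ z ∈ S, (if z ∈ S₀ then 1 else 0) = S₀.card := by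
    rw [← Finset.sum_filter, Finset.sum_const, smul_eq_mul, mul_one,
      Finset.filter_mem_eq_inter, Finset.inter_eq_right.2 (Finset.filter_subset _ _)]
  -- Between consecutive points of `S₀` lies a zero of `G` or a zero of `W`. The latter is outside
  -- `S`, so it is not among the roots whose multiplicity is already charged to `S`.
  have hroll : S₀.card ≤ (T ∪ W.roots.toFinset \ S).card + 1 := by
    refine Finset.card_le_of_interleaved fun x hx y hy hxy hno => ?_
    simp only [hS₀, Finset.mem_filter] at hx hy
    have hIcc : Icc x y ⊆ I := hI.out (hS hx.1) (hS hy.1)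
    by_cases hg : ∃ z ∈ Icc x y, G z = 0
    · obtain ⟨z, hz, hgz⟩ := hg
      refine ⟨z, Finset.mem_union_left _ (hT z (hIcc hz) hgz), ?_, ?_⟩
      · exact lt_of_le_of_ne hz.1 (by rintro rfl; exact hx.2 hgz)
      · exact lt_of_le_of_ne hz.2 (by rintro rfl; exact hy.2 hgz)
    · push Not at hg
      obtain ⟨z, hz, hwz⟩ := exists_wronskian_eq_zero hxy
        (fun z hz => (hF z (hIU (hIcc hz))).differentiableAt)
        (fun z hz => (hG z (hIU (hIcc hz))).differentiableAt) hg (hS0 x hx.1) (hS0 y hy.1)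
      have hz' := Ioo_subset_Icc_self hz
      rw [hWr z (hIU (hIcc hz'))] at hwz
      refine ⟨z, Finset.mem_union_right _ (Finset.mem_sdiff.2 ⟨?_, fun hzS => ?_⟩), hz⟩
      · rw [Multiset.mem_toFinset, Polynomial.mem_roots hW]; exact hwz
      · exact hno z (Finset.mem_filter.2 ⟨hzS, hg z hz'⟩) hz
  have hroots : (W.roots.toFinset \ S).card ≤
      ∑ z ∈ W.roots.toFinset \ S, W.rootMultiplicity z := by
    rw [Finset.card_eq_sum_ones]
    refine Finset.sum_le_sum fun z hz => ?_
    rw [Finset.mem_sdiff, Multiset.mem_toFinset, Polynomial.mem_roots hW] at hz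
    exact (Polynomial.rootMultiplicity_pos hW).2 hz.1
  have hdeg := sum_rootMultiplicity_le_natDegree W (S ∪ W.roots.toFinset \ S)
  rw [Finset.sum_union Finset.disjoint_sdiff] at hdeg
  have hunion := Finset.card_union_le T (W.roots.toFinset \ S)
  omega

/-! ### The transcendental function `log ((1 + s) / (1 - s))` -/

/-- The function `s ↦ log ((1 + s) / (1 - s))` on `(-1, 1)`. -/
def logRatio (s : ℝ) : ℝ := Real.log (1 + s) - Real.log (1 - s)

theorem analyticAt_logRatio {s : ℝ} (hs : s ∈ Ioo (-1 : ℝ) 1) : AnalyticAt ℝ logRatio s := by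
  have h1 : AnalyticAt ℝ (fun s : ℝ => Real.log (1 + s)) s :=
    (analyticAt_const.add analyticAt_id).log (by simp; linarith [hs.1])
  have h2 : AnalyticAt ℝ (fun s : ℝ => Real.log (1 - s)) s :=
    (analyticAt_const.sub analyticAt_id).log (by simp; linarith [hs.2])
  exact h1.sub h2

theorem hasDerivAt_logRatio {s : ℝ} (hs : s ∈ Ioo (-1 : ℝ) 1) :
    HasDerivAt logRatio (2 / (1 - s ^ 2)) s := by
  have a : 1 + s ≠ 0 := by linarith [hs.1]
  have b : 1 - s ≠ 0 := by linarith [hs.2]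
  have h1 : HasDerivAt (fun s : ℝ => Real.log (1 + s)) (1 / (1 + s)) s :=
    ((hasDerivAt_id s).const_add 1).log a
  have h2 : HasDerivAt (fun s : ℝ => Real.log (1 - s)) (-1 / (1 - s)) s :=
    ((hasDerivAt_id s).const_sub 1).log b
  refine (h1.sub h2).congr_deriv ?_
  have c : 1 - s ^ 2 ≠ 0 := by
    rw [show 1 - s ^ 2 = (1 + s) * (1 - s) by ring]; exact mul_ne_zero a b
  field_simp
  ring

theorem tendsto_one_sub_nhdsLT : Tendsto (fun s : ℝ => 1 - s) (𝓝[<] 1) (𝓝[>] 0) := by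
  refine tendsto_nhdsWithin_iff.2 ⟨?_, eventually_nhdsWithin_of_forall fun s hs => ?_⟩
  · have : Tendsto (fun s : ℝ => 1 - s) (𝓝 1) (𝓝 (1 - 1)) := tendsto_const_nhds.sub tendsto_id
    rw [sub_self] at this
    exact this.mono_left nhdsWithin_le_nhds
  · exact sub_pos.2 (mem_Iio.1 hs)

theorem tendsto_log_one_add_nhdsLT :
    Tendsto (fun s : ℝ => Real.log (1 + s)) (𝓝[<] 1) (𝓝 (Real.log (1 + 1))) := by
  have : ContinuousAt (fun s : ℝ => Real.log (1 + s)) 1 :=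
    (continuousAt_const.add continuousAt_id).log (by norm_num)
  exact this.tendsto.mono_left nhdsWithin_le_nhds

theorem tendsto_logRatio_atTop : Tendsto logRatio (𝓝[<] 1) atTop := by
  have h := (Real.tendsto_log_nhdsGT_zero.comp tendsto_one_sub_nhdsLT)
  have h2 := tendsto_neg_atBot_atTop.comp h
  exact tendsto_log_one_add_nhdsLT.add_atTop h2

theorem tendsto_one_sub_mul_logRatio :
    Tendsto (fun s => (1 - s) * logRatio s) (𝓝[<] 1) (𝓝 0) := by
  have h0 : Tendsto (fun s : ℝ => 1 - s) (𝓝[<] 1) (𝓝 0) :=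
    tendsto_one_sub_nhdsLT.mono_right nhdsWithin_le_nhds
  have h1 := h0.mul tendsto_log_one_add_nhdsLT
  have h2 : Tendsto (fun s : ℝ => (1 - s) * Real.log (1 - s)) (𝓝[<] 1) (𝓝 (0 * Real.log 0)) :=
    (Real.continuous_mul_log.tendsto 0).comp h0
  have := h1.sub h2
  simp only [zero_mul, sub_zero] at this
  refine this.congr fun s => ?_
  simp [logRatio]; ring

theorem tendsto_polynomial_eval_nhdsLT (P : Polynomial ℝ) :
    Tendsto (fun s => P.eval s) (𝓝[<] (1 : ℝ)) (𝓝 (P.eval 1)) :=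
  (P.continuous.tendsto 1).mono_left nhdsWithin_le_nhds

theorem eventually_polynomial_eval_ne_zero {P : Polynomial ℝ} (hP : P ≠ 0) :
    ∀ᶠ s in 𝓝[<] (1 : ℝ), P.eval s ≠ 0 := by
  have h : ∀ᶠ s in cofinite, P.eval s ≠ 0 := by
    simpa [Filter.eventually_cofinite, Polynomial.IsRoot] using
      Polynomial.finite_setOfPred_isRoot hP
  have hle : 𝓝[<] (1 : ℝ) ≤ 𝓝[≠] 1 := nhdsWithin_mono _ fun x hx => ne_of_lt hx
  exact (hle.trans (nhdsNE_le_cofinite 1)) h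

/-- As `s → 1`, dividing by `L → ∞` forces `G(1) = 0`. Then `G` has a factor `s - 1`, and `(1 - s) L
→ 0` forces `P(1) = 0`. -/
theorem eval_one_eq_zero_of_add_mul_logRatio {P G : Polynomial ℝ}
    (h : ∀ᶠ s in 𝓝[<] (1 : ℝ), P.eval s + G.eval s * logRatio s = 0) :
    G.eval 1 = 0 ∧ P.eval 1 = 0 := by
  have hG : G.eval 1 = 0 := by
    have h1 := (tendsto_polynomial_eval_nhdsLT P).neg.div_atTop tendsto_logRatio_atTop
    refine tendsto_nhds_unique (tendsto_polynomial_eval_nhdsLT G) (h1.congr' ?_)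
    filter_upwards [h, tendsto_logRatio_atTop.eventually_gt_atTop 0] with s hs hL
    rw [div_eq_iff hL.ne']
    linarith
  refine ⟨hG, ?_⟩
  obtain ⟨G₁, rfl⟩ := Polynomial.dvd_iff_isRoot.2 hG
  have h1 := (tendsto_polynomial_eval_nhdsLT G₁).mul tendsto_one_sub_mul_logRatio
  rw [mul_zero] at h1
  refine tendsto_nhds_unique (tendsto_polynomial_eval_nhdsLT P) (h1.congr' ?_)
  filter_upwards [h] with s hs
  simp only [Polynomial.eval_mul, Polynomial.eval_sub, Polynomial.eval_X, Polynomial.eval_C] at hs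
  linear_combination -hs

/-- `log ((1 + s) / (1 - s))` is not a rational function near `s = 1`. -/
theorem eq_zero_of_eventually_add_mul_logRatio_eq_zero {P G : Polynomial ℝ}
    (h : ∀ᶠ s in 𝓝[<] (1 : ℝ), P.eval s + G.eval s * logRatio s = 0) : P = 0 ∧ G = 0 := by
  -- Descent: `s - 1` divides both `P` and `G`, and cancelling it lowers the degree of `G`.
  have aux : ∀ (d : ℕ) (P G : Polynomial ℝ), G.natDegree ≤ d →
      (∀ᶠ s in 𝓝[<] (1 : ℝ), P.eval s + G.eval s * logRatio s = 0) → G = 0 := by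
    intro d
    induction d with
    | zero =>
      intro P G hd h
      have h1 := (eval_one_eq_zero_of_add_mul_logRatio h).1
      rw [Polynomial.eq_C_of_natDegree_le_zero hd] at h1 ⊢
      simpa using h1
    | succ d ih =>
      intro P G hd h
      obtain ⟨hG, hP⟩ := eval_one_eq_zero_of_add_mul_logRatio h
      obtain ⟨G₁, rfl⟩ := Polynomial.dvd_iff_isRoot.2 hG
      obtain ⟨P₁, rfl⟩ := Polynomial.dvd_iff_isRoot.2 hP
      by_cases h0 : G₁ = 0
      · simp [h0]
      rw [Polynomial.natDegree_mul (Polynomial.X_sub_C_ne_zero 1) h0,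
        Polynomial.natDegree_X_sub_C] at hd
      refine absurd (ih P₁ G₁ (by omega) ?_) h0
      filter_upwards [h, self_mem_nhdsWithin] with s hs hs1
      have : s - 1 ≠ 0 := sub_ne_zero.2 (ne_of_lt hs1)
      refine (mul_eq_zero.1 (?_ : (s - 1) * _ = 0)).resolve_left this
      simp only [Polynomial.eval_mul, Polynomial.eval_sub, Polynomial.eval_X,
        Polynomial.eval_C] at hs
      linear_combination hs
  obtain rfl := aux _ P G le_rfl h
  refine ⟨?_, rfl⟩
  by_contra hP
  obtain ⟨s, h1, h2⟩ := (h.and (eventually_polynomial_eval_ne_zero hP)).exists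
  simp [h2] at h1

/-! ### Zeros of `P s + G s * log ((1 + s) / (1 - s))` -/

theorem analyticAt_add_mul_logRatio (P G : Polynomial ℝ) {s : ℝ} (hs : s ∈ Ioo (-1 : ℝ) 1) :
    AnalyticAt ℝ (fun s => P.eval s + G.eval s * logRatio s) s :=
  (analyticAt_polynomial_eval P s).add
    ((analyticAt_polynomial_eval G s).mul (analyticAt_logRatio hs))

/-- The Wronskian of `P + (1 - X ^ 2) * B * log ((1 + X) / (1 - X))` and `(1 - X ^ 2) * B`. -/
def logWronskian (P B : Polynomial ℝ) : Polynomial ℝ :=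
  P.derivative * ((1 - Polynomial.X ^ 2) * B) -
    P * ((1 - Polynomial.X ^ 2) * B).derivative + 2 * ((1 - Polynomial.X ^ 2) * B ^ 2)

/-- The terms containing `L` cancel. What remains of them is `G² L'`, whose denominator `1 - s²` is
absorbed by the factor built into `G`. -/
theorem wronskian_eq_logWronskian_eval (P B : Polynomial ℝ) {s : ℝ} (hs : s ∈ Ioo (-1 : ℝ) 1) :
    deriv (fun s => P.eval s + ((1 - Polynomial.X ^ 2) * B).eval s * logRatio s) s *
        ((1 - Polynomial.X ^ 2) * B).eval s -
      (P.eval s + ((1 - Polynomial.X ^ 2) * B).eval s * logRatio s) *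
        deriv (fun s => ((1 - Polynomial.X ^ 2) * B).eval s) s = (logWronskian P B).eval s := by
  have hne : 1 - s ^ 2 ≠ 0 := by nlinarith [hs.1, hs.2]
  have h := (P.hasDerivAt s).add
    ((((1 - Polynomial.X ^ 2) * B).hasDerivAt s).mul (hasDerivAt_logRatio hs))
  have h' := h.deriv
  have e : deriv (fun s => P.eval s + ((1 - Polynomial.X ^ 2) * B).eval s * logRatio s) s = _ := h'
  rw [e, Polynomial.deriv]
  simp only [logWronskian, Polynomial.eval_add, Polynomial.eval_sub, Polynomial.eval_mul,
    Polynomial.eval_pow, Polynomial.eval_one, Polynomial.eval_X, Polynomial.eval_ofNat]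
  field_simp
  ring

/-- A vanishing Wronskian would make `F / G` constant near `1`, and `L` would be rational there. -/
theorem logWronskian_ne_zero (P : Polynomial ℝ) {B : Polynomial ℝ} (hB : B ≠ 0) :
    logWronskian P B ≠ 0 := by
  intro h0
  set G : Polynomial ℝ := (1 - Polynomial.X ^ 2) * B with hG
  have hG0 : G ≠ 0 := by
    refine mul_ne_zero (fun h => ?_) hB
    simpa using congrArg (Polynomial.eval 0) h
  set F : ℝ → ℝ := fun s => P.eval s + G.eval s * logRatio s with hF
  have hev : ∀ᶠ s in 𝓝[<] (1 : ℝ), G.eval s ≠ 0 ∧ s ∈ Ioo (-1 : ℝ) 1 :=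
    (eventually_polynomial_eval_ne_zero hG0).and (Ioo_mem_nhdsLT (by norm_num))
  obtain ⟨a, ha, hsub⟩ := (mem_nhdsLT_iff_exists_Ioo_subset).1 hev
  have hderiv : ∀ s ∈ Ioo a 1, HasDerivAt (fun s => F s / G.eval s) 0 s := by
    intro s hs
    obtain ⟨hGs, hs1⟩ := hsub hs
    have hFd := (analyticAt_add_mul_logRatio P G hs1).differentiableAt.hasDerivAt
    have hGd := (analyticAt_polynomial_eval G s).differentiableAt.hasDerivAt
    refine (hFd.div hGd hGs).congr_deriv ?_
    rw [wronskian_eq_logWronskian_eval P B hs1, h0]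
    simp
  obtain ⟨c, hc⟩ : ∃ c, ∀ s ∈ Ioo a 1, F s / G.eval s = c := by
    refine isOpen_Ioo.exists_is_const_of_deriv_eq_zero isPreconnected_Ioo
      (fun s hs => (hderiv s hs).differentiableAt.differentiableWithinAt)
      fun s hs => (hderiv s hs).deriv
  have hlast : ∀ᶠ s in 𝓝[<] (1 : ℝ),
      (P - Polynomial.C c * G).eval s + G.eval s * logRatio s = 0 := by
    filter_upwards [Ioo_mem_nhdsLT ha] with s hs
    have := hc s hs
    rw [div_eq_iff (hsub hs).1] at this
    simp only [Polynomial.eval_sub, Polynomial.eval_mul, Polynomial.eval_C]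
    linear_combination this
  exact hG0 (eq_zero_of_eventually_add_mul_logRatio_eq_zero hlast).2

/-- The condition `e ≤ d` keeps the term `2 (1 - X²) B²`, of degree at most `2e + 2`, within the
bound. -/
theorem natDegree_logWronskian_le {P B : Polynomial ℝ} {d e : ℕ} (hP : P.natDegree ≤ d + 1)
    (hB : B.natDegree ≤ e) (hed : e ≤ d) : (logWronskian P B).natDegree ≤ d + e + 2 := by
  have h2 : (1 - Polynomial.X ^ 2 : Polynomial ℝ).natDegree ≤ 2 := by compute_degree
  have hG : ((1 - Polynomial.X ^ 2) * B).natDegree ≤ 2 + e :=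
    Polynomial.natDegree_mul_le_of_le h2 hB
  have hP' : P.derivative.natDegree ≤ d := (Polynomial.natDegree_derivative_le P).trans (by omega)
  have hG' : ((1 - Polynomial.X ^ 2) * B).derivative.natDegree ≤ 1 + e :=
    (Polynomial.natDegree_derivative_le _).trans (by omega)
  refine Polynomial.natDegree_add_le_of_degree_le ((Polynomial.natDegree_sub_le_of_le
    (Polynomial.natDegree_mul_le_of_le hP' hG)
    (Polynomial.natDegree_mul_le_of_le hP hG')).trans (by omega)) ?_
  · refine (Polynomial.natDegree_mul_le_of_le (m := 0) (n := 2 + 2 * e) ?_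
      (Polynomial.natDegree_mul_le_of_le h2 (Polynomial.natDegree_pow_le_of_le 2 hB))).trans
      (by omega)
    exact (Polynomial.natDegree_ofNat 2).le

/-- The number of zeros of `s Q(s) + C(1 - s ^ 2) log ((1 + s) / (1 - s))` in `(0, 1)`. -/
theorem sum_analyticOrderAt_le {n : ℕ} (hn : 1 ≤ n) {Q C : Polynomial ℝ} (hQ : Q.natDegree ≤ n)
    (hC : C.natDegree ≤ (n + 1) / 2) (hC0 : C.eval 0 = 0) (hne : Q ≠ 0 ∨ C ≠ 0)
    {S : Finset ℝ} (hS : (S : Set ℝ) ⊆ Ioo 0 1) :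
    ∑ s ∈ S, analyticOrderAt (fun s => s * Q.eval s + C.eval (1 - s ^ 2) * logRatio s) s ≤
      (2 * n + (n + 1) / 2 : ℕ) := by
  classical
  -- Without logarithm `F` is the polynomial `X Q`, of degree at most `n + 1`.
  by_cases hC1 : C = 0
  · have hQ0 : Q ≠ 0 := hne.resolve_right (not_not.2 hC1)
    have hXQ : Polynomial.X * Q ≠ 0 := mul_ne_zero Polynomial.X_ne_zero hQ0
    have h1 := sum_rootMultiplicity_le_natDegree (Polynomial.X * Q) S
    rw [Polynomial.natDegree_X_mul hQ0] at h1
    have h2 : (fun s => s * Q.eval s + C.eval (1 - s ^ 2) * logRatio s) =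
        fun s => (Polynomial.X * Q).eval s := by
      funext s; simp [hC1]
    simp_rw [h2, analyticOrderAt_polynomial_eval hXQ]
    rw [← Nat.cast_sum, Nat.cast_le]
    omega
  obtain ⟨B, rfl⟩ : Polynomial.X ∣ C := by
    rwa [Polynomial.X_dvd_iff, Polynomial.coeff_zero_eq_eval_zero]
  have hB : B ≠ 0 := right_ne_zero_of_mul hC1
  rw [Polynomial.natDegree_X_mul hB] at hC
  set Bt : Polynomial ℝ := B.comp (1 - Polynomial.X ^ 2) with hBt
  have hdeg : (1 - Polynomial.X ^ 2 : Polynomial ℝ).natDegree = 2 := by compute_degree!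
  have hBt0 : Bt ≠ 0 := by
    intro h
    rcases Polynomial.comp_eq_zero_iff.1 h with h | ⟨-, h⟩
    · exact hB h
    · rw [h, Polynomial.natDegree_C] at hdeg; omega
  have hBtd : Bt.natDegree ≤ 2 * B.natDegree := by
    rw [hBt, Polynomial.natDegree_comp, hdeg, mul_comm]
  have hFe : (fun s => s * Q.eval s + (Polynomial.X * B).eval (1 - s ^ 2) * logRatio s) =
      fun s => (Polynomial.X * Q).eval s +
        ((1 - Polynomial.X ^ 2) * Bt).eval s * logRatio s := by
    funext s; simp [hBt]
  rw [hFe]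
  -- Only nonnegative `s` matter, so each root of `B` accounts for at most one zero of `Bt`, not
  -- two. Roots above `1` merely add the harmless point `0`.
  set T : Finset ℝ := B.roots.toFinset.image (fun h => √(1 - h)) with hT
  have hTc : T.card ≤ B.natDegree :=
    Finset.card_image_le.trans ((Multiset.toFinset_card_le _).trans B.card_roots')
  have hXQ : (Polynomial.X * Q).natDegree ≤ n + 1 := by
    refine (Polynomial.natDegree_mul_le).trans ?_
    rw [Polynomial.natDegree_X]; omega
  have hWd := natDegree_logWronskian_le hXQ hBtd (by omega)
  have h0S : (0 : ℝ) ∉ S := fun h => lt_irrefl _ (hS h).1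
  -- Adjoining the zero `s = 0` of `F` to `S` improves the final bound by one.
  have key := sum_analyticOrderAt_le_of_wronskian (I := Ico 0 1) (U := Ioo (-1) 1)
    (logWronskian_ne_zero (Polynomial.X * Q) hBt0) ordConnected_Ico isOpen_Ioo
    (fun x hx => ⟨by linarith [hx.1], hx.2⟩)
    (fun z hz => analyticAt_add_mul_logRatio (Polynomial.X * Q) _ hz)
    (fun z _ => analyticAt_polynomial_eval ((1 - Polynomial.X ^ 2) * Bt) z)
    (fun z hz => wronskian_eq_logWronskian_eval _ _ hz) (T := T) ?_ (S := insert 0 S) ?_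
  · rw [Finset.sum_insert h0S] at key
    have hord : 1 ≤ analyticOrderAt (fun s => (Polynomial.X * Q).eval s +
        ((1 - Polynomial.X ^ 2) * Bt).eval s * logRatio s) 0 := by
      refine Order.one_le_iff_ne_zero.2 ((analyticAt_add_mul_logRatio _ _
        (by norm_num)).analyticOrderAt_ne_zero.2 ?_)
      simp [logRatio]
    have h1 := (add_le_add_left hord _).trans key
    -- With `b = deg B ≤ [(n+1)/2] - 1` the left side is at most `(n + 2b + 2) + b + 1`; then `2
    -- [(n+1)/2] ≤ n + 1` is used.
    have h2 : ((logWronskian (Polynomial.X * Q) Bt).natDegree + T.card + 1 : ℕ) ≤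
        1 + (2 * n + (n + 1) / 2) := by omega
    have h3 := h1.trans (Nat.cast_le.2 h2)
    rw [Nat.cast_add, Nat.cast_one] at h3
    exact (ENat.add_le_add_iff_left ENat.one_ne_top).1 h3
  · intro z hz h
    have hz2 : 1 - z ^ 2 ≠ 0 := by nlinarith [hz.1, hz.2]
    simp only [hBt, Polynomial.eval_mul, Polynomial.eval_sub, Polynomial.eval_one,
      Polynomial.eval_pow, Polynomial.eval_X, Polynomial.eval_comp] at h
    rw [hT, Finset.mem_image]
    refine ⟨1 - z ^ 2, ?_, ?_⟩
    · rw [Multiset.mem_toFinset, Polynomial.mem_roots hB]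
      exact (mul_eq_zero.1 h).resolve_left hz2
    · rw [sub_sub_cancel, Real.sqrt_sq hz.1]
  · rw [Finset.coe_insert]
    rintro x (rfl | hx)
    · norm_num
    · exact Ioo_subset_Ico_self (hS hx)

/-! ### The function space that contains the Melnikov functions -/

/-- The functions which on `(0, 1)` have the form `s Q(s) + C(1 - s ^ 2) log ((1 + s) / (1 - s))`
with `deg Q ≤ n`, `deg C ≤ (n + 1) / 2` and `C(0) = 0`. -/
def melnikovSpace (n : ℕ) : Submodule ℝ (ℝ → ℝ) where
  carrier := {f | ∃ Q C : Polynomial ℝ, Q.natDegree ≤ n ∧ C.natDegree ≤ (n + 1) / 2 ∧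
    C.eval 0 = 0 ∧ ∀ s ∈ Ioo (0 : ℝ) 1, f s = s * Q.eval s + C.eval (1 - s ^ 2) * logRatio s}
  zero_mem' := ⟨0, 0, by simp⟩
  add_mem' := by
    rintro f g ⟨Q, C, hQ, hC, h0, hf⟩ ⟨Q', C', hQ', hC', h0', hg⟩
    refine ⟨Q + Q', C + C', Polynomial.natDegree_add_le_of_degree_le hQ hQ',
      Polynomial.natDegree_add_le_of_degree_le hC hC', by simp [h0, h0'], fun s hs => ?_⟩
    rw [Pi.add_apply, hf s hs, hg s hs, Polynomial.eval_add, Polynomial.eval_add]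
    ring
  smul_mem' := by
    rintro c f ⟨Q, C, hQ, hC, h0, hf⟩
    refine ⟨c • Q, c • C, (Polynomial.natDegree_smul_le c Q).trans hQ,
      (Polynomial.natDegree_smul_le c C).trans hC, by simp [h0], fun s hs => ?_⟩
    rw [Pi.smul_apply, hf s hs, Polynomial.eval_smul, Polynomial.eval_smul]
    simp only [smul_eq_mul]
    ring

theorem melnikovSpace_congr {n : ℕ} {f g : ℝ → ℝ} (hf : f ∈ melnikovSpace n)
    (h : ∀ s ∈ Ioo (0 : ℝ) 1, g s = f s) : g ∈ melnikovSpace n := by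
  obtain ⟨Q, C, hQ, hC, h0, hf⟩ := hf
  exact ⟨Q, C, hQ, hC, h0, fun s hs => (h s hs).trans (hf s hs)⟩

theorem melnikovSpace_mono {m n : ℕ} (h : m ≤ n) : melnikovSpace m ≤ melnikovSpace n := by
  rintro f ⟨Q, C, hQ, hC, h0, hf⟩
  exact ⟨Q, C, hQ.trans h, hC.trans (by omega), h0, hf⟩

/-- The factor `h = 1 - s²` has weight two: it raises `deg Q` by two and `deg C` by one, in step
with `(n + 1) / 2`. -/
theorem one_sub_sq_mul_mem_melnikovSpace {n : ℕ} {f : ℝ → ℝ} (hf : f ∈ melnikovSpace n) :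
    (fun s => (1 - s ^ 2) * f s) ∈ melnikovSpace (n + 2) := by
  obtain ⟨Q, C, hQ, hC, h0, hf⟩ := hf
  refine ⟨(1 - Polynomial.X ^ 2) * Q, Polynomial.X * C, ?_, ?_, by simp, fun s hs => ?_⟩
  · have : (1 - Polynomial.X ^ 2 : Polynomial ℝ).natDegree ≤ 2 := by compute_degree
    exact (Polynomial.natDegree_mul_le_of_le this hQ).trans (by omega)
  · have : (Polynomial.X : Polynomial ℝ).natDegree ≤ 1 := Polynomial.natDegree_X_le
    exact (Polynomial.natDegree_mul_le_of_le this hC).trans (by omega)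
  · simp only [hf s hs, Polynomial.eval_mul, Polynomial.eval_sub, Polynomial.eval_one,
      Polynomial.eval_pow, Polynomial.eval_X]
    ring

theorem pow_succ_mem_melnikovSpace (c : ℝ) (n : ℕ) :
    (fun s => c * s ^ (n + 1)) ∈ melnikovSpace n := by
  refine ⟨Polynomial.C c * Polynomial.X ^ n, 0, Polynomial.natDegree_C_mul_X_pow_le c n, by simp,
    by simp, fun s _ => ?_⟩
  simp
  ring

theorem one_sub_sq_mul_logRatio_mem_melnikovSpace :
    (fun s => (1 - s ^ 2) * logRatio s) ∈ melnikovSpace 1 := by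
  refine ⟨0, Polynomial.X, by simp, by simp, by simp, fun s _ => by simp⟩

theorem evalAt_eq_sum (p : MvPolynomial (Fin 2) ℝ) (x y : ℝ) :
    evalAt p x y = ∑ m ∈ p.support, p.coeff m * (x ^ m 0 * y ^ m 1) := by
  simp [evalAt, MvPolynomial.eval_eq']

theorem continuous_evalAt (p : MvPolynomial (Fin 2) ℝ) {x y : ℝ → ℝ} (hx : Continuous x)
    (hy : Continuous y) : Continuous fun t => evalAt p (x t) (y t) := by
  simp_rw [evalAt_eq_sum]
  fun_prop

/-- To see that integrals of polynomials lie in `melnikovSpace n` it suffices to treat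
monomials. -/
theorem integral_evalAt_mem_melnikovSpace {x y ω : ℝ → ℝ → ℝ} {a b : ℝ → ℝ}
    (hx : ∀ s ∈ Ioo (0 : ℝ) 1, Continuous (x s)) (hy : ∀ s ∈ Ioo (0 : ℝ) 1, Continuous (y s))
    (hω : ∀ s ∈ Ioo (0 : ℝ) 1, Continuous (ω s))
    (hmono : ∀ i j, (fun s => ∫ t in a s..b s, x s t ^ i * y s t ^ j * ω s t) ∈
      melnikovSpace (i + j))
    {n : ℕ} {p : MvPolynomial (Fin 2) ℝ} (hp : p.totalDegree ≤ n) :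
    (fun s => ∫ t in a s..b s, evalAt p (x s t) (y s t) * ω s t) ∈ melnikovSpace n := by
  have hsum : (∑ m ∈ p.support, p.coeff m •
      fun s => ∫ t in a s..b s, x s t ^ m 0 * y s t ^ m 1 * ω s t) ∈ melnikovSpace n := by
    refine Submodule.sum_mem _ fun m hm => Submodule.smul_mem _ _ (melnikovSpace_mono ?_ (hmono _ _))
    have := (MvPolynomial.le_totalDegree hm).trans hp
    rwa [Finsupp.sum_fintype _ _ (fun _ => rfl), Fin.sum_univ_two] at this
  refine melnikovSpace_congr hsum fun s hs => ?_
  have hx := hx s hs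
  have hy := hy s hs
  have hω := hω s hs
  simp only [evalAt_eq_sum, Finset.sum_mul, Finset.sum_apply, Pi.smul_apply, smul_eq_mul]
  rw [intervalIntegral.integral_finsetSum fun m _ =>
    Continuous.intervalIntegrable (by fun_prop) _ _]
  refine Finset.sum_congr rfl fun m _ => ?_
  rw [← intervalIntegral.integral_const_mul]
  simp only [mul_assoc]

/-! ### Moments of the hyperbolic arc -/

theorem integral_eq_zero_of_odd {f : ℝ → ℝ} (hf : ∀ x, f (-x) = -f x) (a : ℝ) :
    ∫ x in (-a)..a, f x = 0 := by
  have h := intervalIntegral.integral_comp_neg (a := -a) (b := a) f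
  simp only [hf, intervalIntegral.integral_neg, neg_neg] at h
  linarith

/-- The distance `1 - x` from the centre of the hyperbola `(x - 1) ^ 2 - y ^ 2 = 1 - s ^ 2`, as a
function of `y`. -/
def arcDist (s y : ℝ) : ℝ := √(1 - s ^ 2 + y ^ 2)

theorem arcDist_pos {s : ℝ} (hs : s ∈ Ioo (0 : ℝ) 1) (y : ℝ) : 0 < arcDist s y :=
  Real.sqrt_pos.2 (by nlinarith [hs.1, hs.2, sq_nonneg y])

theorem arcDist_sq {s : ℝ} (hs : s ∈ Ioo (0 : ℝ) 1) (y : ℝ) :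
    arcDist s y ^ 2 = 1 - s ^ 2 + y ^ 2 :=
  Real.sq_sqrt (by nlinarith [hs.1, hs.2, sq_nonneg y])

@[simp] theorem arcDist_self (s : ℝ) : arcDist s s = 1 := by simp [arcDist]

@[simp] theorem arcDist_neg (s y : ℝ) : arcDist s (-y) = arcDist s y := by simp [arcDist]

@[fun_prop] theorem continuous_arcDist (s : ℝ) : Continuous (arcDist s) := by
  unfold arcDist; fun_prop

theorem hasDerivAt_arcDist {s : ℝ} (hs : s ∈ Ioo (0 : ℝ) 1) (y : ℝ) :
    HasDerivAt (arcDist s) (y / arcDist s y) y := by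
  have h0 : 1 - s ^ 2 + y ^ 2 ≠ 0 := by rw [← arcDist_sq hs]; exact (pow_pos (arcDist_pos hs y) 2).ne'
  have h := (((hasDerivAt_id y).pow 2).const_add (1 - s ^ 2)).sqrt h0
  refine h.congr_deriv ?_
  have := (arcDist_pos hs y).ne'
  simp [arcDist]
  field_simp

/-- An antiderivative is `log (y + u)`, and `u = 1` at both ends `y = ±s`. -/
theorem integral_inv_arcDist {s : ℝ} (hs : s ∈ Ioo (0 : ℝ) 1) :
    ∫ y in (-s)..s, (arcDist s y)⁻¹ = logRatio s := by
  have hpos : ∀ y, 0 < y + arcDist s y := by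
    intro y
    have h1 := arcDist_sq hs y
    have h2 := arcDist_pos hs y
    by_contra hy
    nlinarith [hs.1, hs.2]
  have hd : ∀ y ∈ uIcc (-s) s, HasDerivAt (fun y => Real.log (y + arcDist s y))
      (arcDist s y)⁻¹ y := by
    intro y _
    refine (((hasDerivAt_id y).add (hasDerivAt_arcDist hs y)).log (hpos y).ne').congr_deriv ?_
    have h1 := (hpos y).ne'
    have h2 := (arcDist_pos hs y).ne'
    simp only [id_eq, Pi.add_apply]
    field_simp
    ring
  rw [intervalIntegral.integral_eq_sub_of_hasDerivAt hd]
  · simp [logRatio, add_comm, sub_eq_add_neg]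
  · exact ((continuous_arcDist s).inv₀ fun y => (arcDist_pos hs y).ne').intervalIntegrable _ _

/-- The integral of `u ^ a * y ^ j` over the hyperbolic arc, where `u = 1 - x`. -/
def arcMoment (a j : ℕ) (s : ℝ) : ℝ := ∫ y in (-s)..s, arcDist s y ^ a * y ^ j

theorem arcMoment_odd (a k : ℕ) (s : ℝ) : arcMoment a (2 * k + 1) s = 0 :=
  integral_eq_zero_of_odd (fun y => by
    simp [(odd_two_mul_add_one k).neg_pow]) s

theorem arcMoment_zero_zero (s : ℝ) : arcMoment 0 0 s = 2 * s := by
  simp [arcMoment]; ring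

/-- This is the recursion `arcMoment_add_two_zero` continued to `a = -1`; here the logarithm enters,
with its factor `1 - s²`. -/
theorem arcMoment_one_zero {s : ℝ} (hs : s ∈ Ioo (0 : ℝ) 1) :
    arcMoment 1 0 s = s + (1 / 2) * ((1 - s ^ 2) * logRatio s) := by
  have hu : ∀ y, arcDist s y ≠ 0 := fun y => (arcDist_pos hs y).ne'
  have hc : Continuous fun y => (arcDist s y)⁻¹ := (continuous_arcDist s).inv₀ hu
  have hd : ∀ y ∈ uIcc (-s) s, HasDerivAt (fun y => y * arcDist s y)
      (2 * arcDist s y - (1 - s ^ 2) * (arcDist s y)⁻¹) y := by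
    intro y _
    refine ((hasDerivAt_id y).mul (hasDerivAt_arcDist hs y)).congr_deriv ?_
    have h1 := arcDist_sq hs y
    have := hu y
    simp only [id_eq]
    field_simp
    linear_combination (-1) * h1
  have h := intervalIntegral.integral_eq_sub_of_hasDerivAt hd
    (Continuous.intervalIntegrable (by fun_prop) _ _)
  rw [intervalIntegral.integral_sub (Continuous.intervalIntegrable (by fun_prop) _ _)
    (Continuous.intervalIntegrable (by fun_prop) _ _), intervalIntegral.integral_const_mul,
    intervalIntegral.integral_const_mul, integral_inv_arcDist hs] at h
  simp only [arcDist_neg, arcDist_self] at h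
  simp only [arcMoment, pow_one, pow_zero, mul_one]
  linarith

/-- Integrate the derivative of `y u^(a+2)`, using `y² = u² - (1 - s²)`; the boundary terms give
`2s`. -/
theorem arcMoment_add_two_zero (a : ℕ) {s : ℝ} (hs : s ∈ Ioo (0 : ℝ) 1) :
    (a + 3) * arcMoment (a + 2) 0 s = 2 * s + (a + 2) * ((1 - s ^ 2) * arcMoment a 0 s) := by
  have hd : ∀ y ∈ uIcc (-s) s, HasDerivAt (fun y => y * arcDist s y ^ (a + 2))
      ((a + 3) * arcDist s y ^ (a + 2) - (a + 2) * (1 - s ^ 2) * arcDist s y ^ a) y := by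
    intro y _
    refine ((hasDerivAt_id y).mul ((hasDerivAt_arcDist hs y).pow (a + 2))).congr_deriv ?_
    have h1 := arcDist_sq hs y
    have := (arcDist_pos hs y).ne'
    simp only [id_eq, Pi.pow_apply, Nat.add_succ_sub_one, pow_succ]
    push_cast
    field_simp
    linear_combination (-(a + 2 : ℝ)) * h1
  have h := intervalIntegral.integral_eq_sub_of_hasDerivAt hd
    (Continuous.intervalIntegrable (by fun_prop) _ _)
  rw [intervalIntegral.integral_sub (Continuous.intervalIntegrable (by fun_prop) _ _)
    (Continuous.intervalIntegrable (by fun_prop) _ _), intervalIntegral.integral_const_mul,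
    intervalIntegral.integral_const_mul] at h
  simp only [arcDist_neg, arcDist_self] at h
  simp only [arcMoment, pow_zero, mul_one]
  linear_combination h

theorem arcMoment_add_two (a j : ℕ) {s : ℝ} (hs : s ∈ Ioo (0 : ℝ) 1) :
    arcMoment a (j + 2) s = arcMoment (a + 2) j s - (1 - s ^ 2) * arcMoment a j s := by
  unfold arcMoment
  rw [← intervalIntegral.integral_const_mul, ← intervalIntegral.integral_sub
    (Continuous.intervalIntegrable (by fun_prop) _ _)
    (Continuous.intervalIntegrable (by fun_prop) _ _)]
  congr 1
  funext y
  rw [pow_add _ a 2, arcDist_sq hs]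
  ring

theorem arcMoment_zero_mem_melnikovSpace (a : ℕ) : arcMoment a 0 ∈ melnikovSpace a := by
  induction a using Nat.twoStepInduction with
  | zero =>
    exact melnikovSpace_congr (pow_succ_mem_melnikovSpace 2 0) fun s _ => by
      simp [arcMoment_zero_zero]
  | one =>
    have h := (melnikovSpace 1).add_mem
      (melnikovSpace_mono zero_le_one (pow_succ_mem_melnikovSpace 1 0))
      ((melnikovSpace 1).smul_mem (1 / 2) one_sub_sq_mul_logRatio_mem_melnikovSpace)
    exact melnikovSpace_congr h fun s hs => by simp [arcMoment_one_zero hs]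
  | more a ih _ =>
    have h := (melnikovSpace (a + 2)).smul_mem ((a : ℝ) + 3)⁻¹ ((melnikovSpace (a + 2)).add_mem
      (melnikovSpace_mono zero_le (pow_succ_mem_melnikovSpace 2 0))
      ((melnikovSpace (a + 2)).smul_mem ((a : ℝ) + 2) (one_sub_sq_mul_mem_melnikovSpace ih)))
    refine melnikovSpace_congr h fun s hs => ?_
    have h1 := arcMoment_add_two_zero a hs
    have h2 : (a : ℝ) + 3 ≠ 0 := by positivity
    simp only [Pi.smul_apply, Pi.add_apply, smul_eq_mul, zero_add, pow_one]
    rw [← h1]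
    field_simp

theorem arcMoment_even_mem_melnikovSpace (k : ℕ) :
    ∀ a, arcMoment a (2 * k) ∈ melnikovSpace (a + 2 * k) := by
  induction k with
  | zero => exact arcMoment_zero_mem_melnikovSpace
  | succ k ih =>
    intro a
    have h1 := ih (a + 2)
    have h2 := one_sub_sq_mul_mem_melnikovSpace (ih a)
    rw [show a + 2 + 2 * k = a + 2 * (k + 1) by ring] at h1
    rw [show a + 2 * k + 2 = a + 2 * (k + 1) by ring] at h2
    exact melnikovSpace_congr ((melnikovSpace _).sub_mem h1 h2) fun s hs =>
      arcMoment_add_two a (2 * k) hs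

theorem arcMoment_mem_melnikovSpace (a j : ℕ) : arcMoment a j ∈ melnikovSpace (a + j) := by
  obtain ⟨k, rfl | rfl⟩ := j.even_or_odd'
  · exact arcMoment_even_mem_melnikovSpace k a
  · exact melnikovSpace_congr (Submodule.zero_mem _) fun s _ => arcMoment_odd a k s

/-- The integral of `y ^ (2 k + 2) / u` over the hyperbolic arc, where `u = 1 - x`. -/
theorem integral_pow_mul_inv_arcDist_mem_melnikovSpace (k : ℕ) :
    (fun s => ∫ y in (-s)..s, y ^ (2 * k + 2) * (arcDist s y)⁻¹) ∈ melnikovSpace (2 * k + 1) := by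
  have hrec : ∀ j : ℕ, ∀ s ∈ Ioo (0 : ℝ) 1, (∫ y in (-s)..s, y ^ (j + 2) * (arcDist s y)⁻¹) =
      arcMoment 1 j s - (1 - s ^ 2) * ∫ y in (-s)..s, y ^ j * (arcDist s y)⁻¹ := by
    intro j s hs
    have hu : ∀ y, arcDist s y ≠ 0 := fun y => (arcDist_pos hs y).ne'
    have hc : Continuous fun y => (arcDist s y)⁻¹ := (continuous_arcDist s).inv₀ hu
    unfold arcMoment
    rw [← intervalIntegral.integral_const_mul, ← intervalIntegral.integral_sub
      (Continuous.intervalIntegrable (by fun_prop) _ _)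
      (Continuous.intervalIntegrable (by fun_prop) _ _)]
    congr 1
    funext y
    have h1 := arcDist_sq hs y
    have := hu y
    field_simp
    rw [pow_add]
    linear_combination (-y ^ j) * h1
  induction k with
  -- The integral of `1 / u` alone is `L` without a factor `1 - s²`; the recursion supplies that
  -- factor.
  | zero =>
    refine melnikovSpace_congr ((melnikovSpace 1).sub_mem (arcMoment_mem_melnikovSpace 1 0)
      one_sub_sq_mul_logRatio_mem_melnikovSpace) fun s hs => ?_
    rw [hrec _ s hs]
    simp [integral_inv_arcDist hs]
  | succ k ih =>
    have h1 := arcMoment_mem_melnikovSpace 1 (2 * k + 2)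
    have h2 := one_sub_sq_mul_mem_melnikovSpace ih
    rw [show 1 + (2 * k + 2) = 2 * (k + 1) + 1 by ring] at h1
    exact melnikovSpace_congr ((melnikovSpace _).sub_mem h1 h2) fun s hs => hrec _ s hs

/-- The weight `y / u` comes from `dx = -(y / u) dy`. Its denominator cancels if `a > 0`; if `a =
0`, parity leaves only the integrals of `y^(2k+2) / u`. -/
theorem integral_arcDist_pow_mul_deriv_mem_melnikovSpace (a j : ℕ) :
    (fun s => ∫ y in (-s)..s, arcDist s y ^ a * y ^ j * (y / arcDist s y)) ∈
      melnikovSpace (a + j) := by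
  cases a with
  | zero =>
    obtain ⟨k, rfl | rfl⟩ := j.even_or_odd'
    · refine melnikovSpace_congr (Submodule.zero_mem _) fun s _ => integral_eq_zero_of_odd ?_ s
      intro y
      simp [(even_two_mul k).neg_pow, neg_div]
    · rw [zero_add]
      refine melnikovSpace_congr (integral_pow_mul_inv_arcDist_mem_melnikovSpace k) fun s _ => ?_
      congr 1
      funext y
      ring
  | succ a =>
    rw [show a + 1 + j = a + (j + 1) by ring]
    refine melnikovSpace_congr (arcMoment_mem_melnikovSpace a (j + 1)) fun s hs => ?_
    unfold arcMoment
    congr 1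
    funext y
    have := (arcDist_pos hs y).ne'
    field_simp
    ring

/-- Passage from powers of `u` to powers of `x = 1 - u`. -/
theorem integral_one_sub_arcDist_pow_mem_melnikovSpace {ω : ℝ → ℝ → ℝ}
    (hω : ∀ s ∈ Ioo (0 : ℝ) 1, Continuous (ω s))
    (hmono : ∀ a j, (fun s => ∫ y in (-s)..s, arcDist s y ^ a * y ^ j * ω s y) ∈
      melnikovSpace (a + j)) (i j : ℕ) :
    (fun s => ∫ y in (-s)..s, (1 - arcDist s y) ^ i * y ^ j * ω s y) ∈ melnikovSpace (i + j) := by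
  -- The additional power `u^a` makes induction on `i` possible, via `(1 - u)^(i+1) u^a = (1 - u)^i
  -- u^a - (1 - u)^i u^(a+1)`.
  have aux : ∀ i a, (fun s => ∫ y in (-s)..s,
      (1 - arcDist s y) ^ i * (arcDist s y ^ a * y ^ j * ω s y)) ∈ melnikovSpace (i + (a + j)) := by
    intro i
    induction i with
    | zero => intro a; simpa using hmono a j
    | succ i ih =>
      intro a
      have h1 := melnikovSpace_mono (n := i + 1 + (a + j)) (by omega) (ih a)
      have h2 := ih (a + 1)
      rw [show i + (a + 1 + j) = i + 1 + (a + j) by ring] at h2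
      refine melnikovSpace_congr ((melnikovSpace _).sub_mem h1 h2) fun s hs => ?_
      have hω := hω s hs
      rw [Pi.sub_apply, ← intervalIntegral.integral_sub
        (Continuous.intervalIntegrable (by fun_prop) _ _)
        (Continuous.intervalIntegrable (by fun_prop) _ _)]
      congr 1
      funext y
      ring
  have h := aux i 0
  rw [zero_add] at h
  refine melnikovSpace_congr h fun s _ => ?_
  simp only [pow_zero, one_mul, mul_assoc]

/-! ### Melnikov functions in the variable `s = √(1 - h)` -/

theorem melnikovPlus_one_sub_sq (P : Perturbation) {s : ℝ} (hs : s ∈ Ioo (0 : ℝ) 1) :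
    melnikovPlus P (1 - s ^ 2) =
      -(∫ y in (-s)..s, evalAt P.qPlus (1 - arcDist s y) y * (y / arcDist s y)) -
        ∫ y in (-s)..s, evalAt P.pPlus (1 - arcDist s y) y * 1 := by
  have hd : ∀ y, deriv (fun y => 1 - arcDist s y) y = -(y / arcDist s y) := fun y =>
    ((hasDerivAt_arcDist hs y).const_sub 1).deriv
  have hx : Continuous fun y => 1 - arcDist s y := by fun_prop
  have hp := continuous_evalAt P.pPlus hx continuous_id
  have hq := continuous_evalAt P.qPlus hx continuous_id
  have hω : Continuous fun y => y / arcDist s y :=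
    continuous_id.div (continuous_arcDist s) fun y => (arcDist_pos hs y).ne'
  simp only [id_eq] at hp hq
  rw [← intervalIntegral.integral_neg, ← intervalIntegral.integral_sub
    (Continuous.intervalIntegrable (by fun_prop) _ _)
    (Continuous.intervalIntegrable (by fun_prop) _ _)]
  unfold melnikovPlus lineIntegral
  rw [sub_sub_cancel, Real.sqrt_sq hs.1.le]
  congr 1
  funext y
  have := hd y
  unfold arcDist at this ⊢
  rw [this, deriv_id'']
  ring

theorem melnikovMinus_one_sub_sq (P : Perturbation) {s : ℝ} (hs : s ∈ Ioo (0 : ℝ) 1) :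
    melnikovMinus P (1 - s ^ 2) =
      -(∫ θ in (Real.pi / 2)..(3 * Real.pi / 2),
          evalAt P.qMinus (s * Real.cos θ) (s * Real.sin θ) * (s * Real.sin θ)) -
        ∫ θ in (Real.pi / 2)..(3 * Real.pi / 2),
          evalAt P.pMinus (s * Real.cos θ) (s * Real.sin θ) * (s * Real.cos θ) := by
  have hx : Continuous fun θ => s * Real.cos θ := by fun_prop
  have hy : Continuous fun θ => s * Real.sin θ := by fun_prop
  have hp := continuous_evalAt P.pMinus hx hy
  have hq := continuous_evalAt P.qMinus hx hy
  rw [← intervalIntegral.integral_neg, ← intervalIntegral.integral_sub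
    (Continuous.intervalIntegrable (by fun_prop) _ _)
    (Continuous.intervalIntegrable (by fun_prop) _ _)]
  unfold melnikovMinus lineIntegral
  rw [sub_sub_cancel, Real.sqrt_sq hs.1.le]
  congr 1
  funext θ
  rw [((Real.hasDerivAt_cos θ).const_mul s).deriv, ((Real.hasDerivAt_sin θ).const_mul s).deriv]
  ring

theorem integral_circle_monomial_mem_melnikovSpace (c : ℝ → ℝ) (i j : ℕ) :
    (fun s => ∫ θ in (Real.pi / 2)..(3 * Real.pi / 2),
      (s * Real.cos θ) ^ i * (s * Real.sin θ) ^ j * (s * c θ)) ∈ melnikovSpace (i + j) := by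
  refine melnikovSpace_congr (pow_succ_mem_melnikovSpace
    (∫ θ in (Real.pi / 2)..(3 * Real.pi / 2), Real.cos θ ^ i * Real.sin θ ^ j * c θ) (i + j))
    fun s _ => ?_
  rw [← intervalIntegral.integral_mul_const]
  congr 1
  funext θ
  ring

theorem melnikov_mem_melnikovSpace {P : Perturbation} {n : ℕ} (hP : P.DegreeLE n) :
    (fun s => melnikov P (1 - s ^ 2)) ∈ melnikovSpace n := by
  obtain ⟨h1, h2, h3, h4⟩ := hP
  have hx : ∀ s ∈ Ioo (0 : ℝ) 1, Continuous fun y => 1 - arcDist s y := fun s _ => by fun_prop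
  have hω : ∀ s ∈ Ioo (0 : ℝ) 1, Continuous fun y => y / arcDist s y := fun s hs =>
    continuous_id.div (continuous_arcDist s) fun y => (arcDist_pos hs y).ne'
  have hqp := integral_evalAt_mem_melnikovSpace hx (fun _ _ => continuous_id) hω
    (integral_one_sub_arcDist_pow_mem_melnikovSpace hω
      integral_arcDist_pow_mul_deriv_mem_melnikovSpace) h2
  have hpp := integral_evalAt_mem_melnikovSpace hx (fun _ _ => continuous_id)
    (ω := fun _ _ => 1) (fun _ _ => continuous_const)
    (integral_one_sub_arcDist_pow_mem_melnikovSpace (fun _ _ => continuous_const)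
      fun a j => by
        simp only [mul_one]; exact arcMoment_mem_melnikovSpace a j) h1
  have hqm := integral_evalAt_mem_melnikovSpace (fun _ _ => by fun_prop) (fun _ _ => by fun_prop)
    (fun _ _ => by fun_prop) (integral_circle_monomial_mem_melnikovSpace Real.sin) h4
  have hpm := integral_evalAt_mem_melnikovSpace (fun _ _ => by fun_prop) (fun _ _ => by fun_prop)
    (fun _ _ => by fun_prop) (integral_circle_monomial_mem_melnikovSpace Real.cos) h3
  refine melnikovSpace_congr ((melnikovSpace n).add_mem
    ((melnikovSpace n).sub_mem ((melnikovSpace n).neg_mem hqp) hpp)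
    ((melnikovSpace n).sub_mem ((melnikovSpace n).neg_mem hqm) hpm)) fun s hs => ?_
  rw [melnikov, melnikovPlus_one_sub_sq P hs, melnikovMinus_one_sub_sq P hs]
  rfl

/-! ### The upper bound -/

theorem sqrt_one_sub_mem_Ioo {h : ℝ} (hh : h ∈ Ioo (0 : ℝ) 1) : √(1 - h) ∈ Ioo (0 : ℝ) 1 :=
  ⟨Real.sqrt_pos.2 (by linarith [hh.2]),
    (Real.sqrt_lt' one_pos).2 (by linarith [hh.1])⟩

theorem one_sub_sqrt_sq {h : ℝ} (hh : h ∈ Ioo (0 : ℝ) 1) : 1 - √(1 - h) ^ 2 = h := by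
  rw [Real.sq_sqrt (by linarith [hh.2])]; ring

/-- Passing from `s` to `h = 1 - s ^ 2` preserves analyticity and orders of zeros. -/
theorem analyticOrderAt_of_eqOn_comp_sqrt {f F : ℝ → ℝ}
    (hfF : ∀ s ∈ Ioo (0 : ℝ) 1, f (1 - s ^ 2) = F s) {h : ℝ} (hh : h ∈ Ioo (0 : ℝ) 1) :
    (AnalyticAt ℝ F (√(1 - h)) → AnalyticAt ℝ f h) ∧
      analyticOrderAt f h = analyticOrderAt F (√(1 - h)) := by
  have hne : 1 - h ≠ 0 := by linarith [hh.2]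
  have hg : AnalyticAt ℝ (fun h : ℝ => √(1 - h)) h :=
    (Real.contDiffAt_sqrt hne).analyticAt.fun_comp (f := fun h : ℝ => 1 - h)
      (analyticAt_const.sub analyticAt_id)
  have hg' : deriv (fun h : ℝ => √(1 - h)) h ≠ 0 := by
    have hd : HasDerivAt (fun h : ℝ => √(1 - h)) (-1 / (2 * √(1 - h))) h :=
      ((hasDerivAt_id h).const_sub 1).sqrt hne
    rw [hd.deriv]
    have := (sqrt_one_sub_mem_Ioo hh).1
    exact div_ne_zero (by norm_num) (by simpa using this.ne')
  have hev : f =ᶠ[𝓝 h] F ∘ fun h : ℝ => √(1 - h) := by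
    filter_upwards [isOpen_Ioo.mem_nhds hh] with t ht
    have := hfF _ (sqrt_one_sub_mem_Ioo ht)
    rwa [one_sub_sqrt_sq ht] at this
  exact ⟨fun hF => (AnalyticAt.comp (g := F) (f := fun h : ℝ => √(1 - h)) hF hg).congr hev.symm,
    (analyticOrderAt_congr hev).trans (analyticOrderAt_comp_of_deriv_ne_zero hg hg')⟩

theorem numZerosMult_melnikov_le {n : ℕ} (hn : 1 ≤ n) {P : Perturbation} (hP : P ∈ admissible n) :
    numZerosMult (melnikov P) ≤ (2 * n + (n + 1) / 2 : ℕ) := by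
  classical
  obtain ⟨hdeg, h₀, hh₀, hne⟩ := hP
  obtain ⟨Q, C, hQ, hC, hC0, hF⟩ := melnikov_mem_melnikovSpace hdeg
  have hQC : Q ≠ 0 ∨ C ≠ 0 := by
    by_contra! hcon
    have := hF _ (sqrt_one_sub_mem_Ioo hh₀)
    simp only [one_sub_sqrt_sq hh₀, hcon.1, hcon.2] at this
    exact hne (by simpa using this)
  refine iSup₂_le fun S hS => ?_
  have hinj : InjOn (fun h : ℝ => √(1 - h)) (S : Set ℝ) := by
    intro a ha b hb hab
    simp only at hab
    rw [← one_sub_sqrt_sq (hS ha), ← one_sub_sqrt_sq (hS hb), hab]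
  rw [Finset.sum_congr rfl fun h hh => (analyticOrderAt_of_eqOn_comp_sqrt hF (hS hh)).2,
    ← Finset.sum_image (f := fun s => analyticOrderAt
      (fun s => s * Q.eval s + C.eval (1 - s ^ 2) * logRatio s) s) hinj]
  refine sum_analyticOrderAt_le hn hQ hC hC0 hQC ?_
  rw [Finset.coe_image]
  rintro _ ⟨h, hh, rfl⟩
  exact sqrt_one_sub_mem_Ioo (hS hh)

theorem numZeros_le_numZerosMult {f : ℝ → ℝ} (hf : ∀ h ∈ Ioo (0 : ℝ) 1, AnalyticAt ℝ f h) :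
    numZeros f ≤ numZerosMult f := by
  have hfin : ∀ S : Finset ℝ, (S : Set ℝ) ⊆ {h ∈ Ioo (0 : ℝ) 1 | f h = 0} →
      (S.card : ℕ∞) ≤ numZerosMult f := by
    intro S hS
    refine le_trans ?_ (le_iSup₂_of_le S (fun h hh => (hS hh).1) le_rfl)
    rw [Finset.card_eq_sum_ones, Nat.cast_sum, Nat.cast_one]
    exact Finset.sum_le_sum fun h hh => Order.one_le_iff_ne_zero.2
      ((hf h (hS hh).1).analyticOrderAt_ne_zero.2 (hS hh).2)
  rcases Set.finite_or_infinite {h ∈ Ioo (0 : ℝ) 1 | f h = 0} with hZ | hZ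
  · have := hfin hZ.toFinset (by simp)
    rwa [← Set.encard_coe_eq_coe_finsetCard, hZ.coe_toFinset] at this
  · have : numZerosMult f = ⊤ := by
      refine ENat.eq_top_iff_forall_ge.2 fun m => ?_
      obtain ⟨t, ht, rfl⟩ := hZ.exists_subset_card_eq m
      exact hfin t ht
    rw [this]
    exact le_top

theorem analyticAt_melnikov {P : Perturbation} {n : ℕ} (hP : P.DegreeLE n) {h : ℝ}
    (hh : h ∈ Ioo (0 : ℝ) 1) : AnalyticAt ℝ (melnikov P) h := by
  obtain ⟨Q, C, -, -, -, hF⟩ := melnikov_mem_melnikovSpace hP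
  refine (analyticOrderAt_of_eqOn_comp_sqrt hF hh).1 ?_
  have hs := sqrt_one_sub_mem_Ioo hh
  have := analyticAt_add_mul_logRatio (Polynomial.X * Q) (C.comp (1 - Polynomial.X ^ 2))
    (s := √(1 - h)) ⟨by linarith [hs.1], hs.2⟩
  simpa using this

theorem Z_le_ZMult (n : ℕ) : Z n ≤ ZMult n :=
  iSup₂_mono fun _ hP => numZeros_le_numZerosMult fun _ hh => analyticAt_melnikov hP.1 hh

theorem ZMult_le {n : ℕ} (hn : 1 ≤ n) : ZMult n ≤ (2 * n + (n + 1) / 2 : ℕ) :=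
  iSup₂_le fun _ hP => numZerosMult_melnikov_le hn hP

/-! ### The lower bound -/

/-- The integral of `cos ^ (d + 1)` over the left half circle. -/
def circleMoment (d : ℕ) : ℝ := ∫ θ in (Real.pi / 2)..(3 * Real.pi / 2), Real.cos θ ^ (d + 1)

/-- The cosine is negative throughout the open half circle, so its powers keep one sign. -/
theorem circleMoment_ne_zero (d : ℕ) : circleMoment d ≠ 0 := by
  have hpos : 0 < ∫ θ in (Real.pi / 2)..(3 * Real.pi / 2), (-Real.cos θ) ^ (d + 1) := by
    refine intervalIntegral.intervalIntegral_pos_of_pos_on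
      (Continuous.intervalIntegrable (by fun_prop) _ _) (fun θ hθ => ?_)
      (by linarith [Real.pi_pos])
    exact pow_pos (neg_pos.2 (Real.cos_neg_of_pi_div_two_lt_of_lt hθ.1 (by linarith [hθ.2]))) _
  intro h0
  have : ∀ θ, (-Real.cos θ) ^ (d + 1) = (-1) ^ (d + 1) * Real.cos θ ^ (d + 1) := fun θ => neg_pow _ _
  simp_rw [this] at hpos
  rw [intervalIntegral.integral_const_mul, show (∫ θ in (Real.pi / 2)..(3 * Real.pi / 2),
    Real.cos θ ^ (d + 1)) = 0 from h0, mul_zero] at hpos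
  exact lt_irrefl _ hpos

/-- The logarithmic coefficient starts at `1/2` and is multiplied by `(2m + 3) / (2m + 4)` at each
step, so it never vanishes. -/
theorem exists_arcMoment_odd_eq (m : ℕ) : ∃ (Q : Polynomial ℝ) (c : ℝ), c ≠ 0 ∧
    ∀ s ∈ Ioo (0 : ℝ) 1, arcMoment (2 * m + 1) 0 s =
      s * Q.eval s + c * (1 - s ^ 2) ^ (m + 1) * logRatio s := by
  induction m with
  | zero =>
    refine ⟨1, 1 / 2, by norm_num, fun s hs => ?_⟩
    simp only [mul_zero, zero_add, arcMoment_one_zero hs, Polynomial.eval_one]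
    ring
  | succ m ih =>
    obtain ⟨Q, c, hc, h⟩ := ih
    have h4 : (2 * m + 4 : ℝ) ≠ 0 := by positivity
    refine ⟨Polynomial.C (2 * m + 4 : ℝ)⁻¹ *
      (2 + Polynomial.C (2 * m + 3 : ℝ) * ((1 - Polynomial.X ^ 2) * Q)),
      (2 * m + 4 : ℝ)⁻¹ * (2 * m + 3) * c,
      mul_ne_zero (mul_ne_zero (inv_ne_zero h4) (by positivity)) hc, fun s hs => ?_⟩
    have h1 := arcMoment_add_two_zero (2 * m + 1) hs
    rw [h s hs] at h1
    push_cast at h1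
    simp only [Polynomial.eval_add, Polynomial.eval_sub, Polynomial.eval_mul,
      Polynomial.eval_pow, Polynomial.eval_one, Polynomial.eval_X, Polynomial.eval_C,
      Polynomial.eval_ofNat]
    rw [show 2 * (m + 1) + 1 = 2 * m + 1 + 2 by ring]
    field_simp
    linear_combination h1

/-- Perturbations of `ẋ` by polynomials in `x`: odd powers of `1 - x` for `x ≥ 0`, arbitrary
powers of `x` for `x < 0`. -/
def powerPerturbation {k l : ℕ} (a : Fin k ⊕ Fin l → ℝ) : Perturbation where
  pPlus := ∑ m : Fin l, C (a (Sum.inr m)) * (1 - X 0) ^ (2 * (m : ℕ) + 1)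
  qPlus := 0
  pMinus := ∑ d : Fin k, C (a (Sum.inl d)) * X 0 ^ (d : ℕ)
  qMinus := 0

theorem degreeLE_powerPerturbation (n : ℕ) (a : Fin (n + 1) ⊕ Fin ((n + 1) / 2) → ℝ) :
    (powerPerturbation a).DegreeLE n := by
  refine ⟨?_, by simp [powerPerturbation], ?_, by simp [powerPerturbation]⟩
  · refine MvPolynomial.totalDegree_finsetSum_le fun m _ => ?_
    have h1 : (1 - X 0 : MvPolynomial (Fin 2) ℝ).totalDegree ≤ 1 :=
      (MvPolynomial.totalDegree_sub _ _).trans (by simp)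
    refine (MvPolynomial.totalDegree_mul _ _).trans ?_
    rw [MvPolynomial.totalDegree_C, zero_add]
    refine (MvPolynomial.totalDegree_pow _ _).trans ((Nat.mul_le_mul_left _ h1).trans ?_)
    have := m.2
    omega
  · refine MvPolynomial.totalDegree_finsetSum_le fun d _ => ?_
    refine (MvPolynomial.totalDegree_mul _ _).trans ?_
    rw [MvPolynomial.totalDegree_C, zero_add, MvPolynomial.totalDegree_X_pow]
    have := d.2
    omega

/-- The Melnikov functions of the basic power perturbations. -/
def basicMelnikov {k l : ℕ} : Fin k ⊕ Fin l → ℝ → ℝ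
  | Sum.inl d => fun s => -(circleMoment d * s ^ ((d : ℕ) + 1))
  | Sum.inr m => fun s => -arcMoment (2 * m + 1) 0 s

theorem melnikov_powerPerturbation {k l : ℕ} (a : Fin k ⊕ Fin l → ℝ) {s : ℝ}
    (hs : s ∈ Ioo (0 : ℝ) 1) :
    melnikov (powerPerturbation a) (1 - s ^ 2) = ∑ i, a i * basicMelnikov i s := by
  rw [melnikov, melnikovPlus_one_sub_sq _ hs, melnikovMinus_one_sub_sq _ hs, Fintype.sum_sum_type]
  simp only [powerPerturbation, evalAt, map_sum, map_mul, map_pow, map_sub, map_one, map_zero,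
    MvPolynomial.eval_C, MvPolynomial.eval_X, Matrix.cons_val_zero, zero_mul, mul_one,
    intervalIntegral.integral_zero, neg_zero, zero_sub, sub_sub_cancel, Finset.sum_mul,
    basicMelnikov]
  rw [intervalIntegral.integral_finsetSum fun m _ =>
      Continuous.intervalIntegrable (by fun_prop) _ _,
    intervalIntegral.integral_finsetSum fun m _ =>
      Continuous.intervalIntegrable (by fun_prop) _ _, add_comm, ← Finset.sum_neg_distrib,
    ← Finset.sum_neg_distrib]
  congr 1
  · refine Finset.sum_congr rfl fun d _ => ?_
    rw [circleMoment, ← intervalIntegral.integral_mul_const, mul_neg,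
      ← intervalIntegral.integral_const_mul]
    congr 2
    funext θ
    ring
  · refine Finset.sum_congr rfl fun m _ => ?_
    rw [arcMoment, intervalIntegral.integral_const_mul]
    simp

/-- Since `L` is not rational, the polynomial part and the coefficient of `L` vanish separately. The
latter, in powers of `1 - s²`, kills the arc coefficients; only then does the former reduce to pure
powers of `s` and kill the rest. -/
theorem eq_zero_of_sum_basicMelnikov_eq_zero {k l : ℕ} {a : Fin k ⊕ Fin l → ℝ}
    (h : ∀ s ∈ Ioo (0 : ℝ) 1, ∑ i, a i * basicMelnikov i s = 0) : a = 0 := by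
  choose Q c hc hQ using exists_arcMoment_odd_eq
  set P : Polynomial ℝ := ∑ d : Fin k, Polynomial.C (a (Sum.inl d) * circleMoment d) *
      Polynomial.X ^ ((d : ℕ) + 1) +
    Polynomial.X * ∑ m : Fin l, Polynomial.C (a (Sum.inr m)) * Q m with hP
  set B : Polynomial ℝ := ∑ m : Fin l, Polynomial.C (a (Sum.inr m) * c m) *
    Polynomial.X ^ ((m : ℕ) + 1) with hB
  have hev : ∀ᶠ s in 𝓝[<] (1 : ℝ),
      P.eval s + (B.comp (1 - Polynomial.X ^ 2)).eval s * logRatio s = 0 := by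
    filter_upwards [Ioo_mem_nhdsLT one_pos] with s hs
    have h1 := h s hs
    rw [Fintype.sum_sum_type] at h1
    simp only [basicMelnikov, hQ _ s hs] at h1
    simp only [hP, hB, Polynomial.eval_add, Polynomial.eval_finsetSum, Polynomial.eval_mul,
      Polynomial.eval_C, Polynomial.eval_pow, Polynomial.eval_X, Polynomial.eval_comp,
      Polynomial.eval_sub, Polynomial.eval_one]
    rw [← neg_eq_zero, ← h1, Finset.mul_sum, Finset.sum_mul, add_assoc, ← Finset.sum_add_distrib,
      neg_add, ← Finset.sum_neg_distrib, ← Finset.sum_neg_distrib]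
    congr 1 <;> exact Finset.sum_congr rfl fun _ _ => by ring
  obtain ⟨hP0, hB0⟩ := eq_zero_of_eventually_add_mul_logRatio_eq_zero hev
  have hdeg : (1 - Polynomial.X ^ 2 : Polynomial ℝ).natDegree = 2 := by compute_degree!
  have hB0 : B = 0 := by
    rcases Polynomial.comp_eq_zero_iff.1 hB0 with h | ⟨-, h⟩
    · exact h
    · rw [h, Polynomial.natDegree_C] at hdeg; omega
  have coeff_sum : ∀ {j : ℕ} (b : Fin j → ℝ) (i : Fin j),
      (∑ m : Fin j, Polynomial.C (b m) * Polynomial.X ^ ((m : ℕ) + 1)).coeff (i + 1) = b i := by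
    intro j b i
    simp only [Polynomial.finsetSum_coeff, Polynomial.coeff_C_mul_X_pow, add_left_inj,
      Fin.val_inj]
    simp
  have hr : ∀ m, a (Sum.inr m) = 0 := by
    intro m
    have := coeff_sum (fun m : Fin l => a (Sum.inr m) * c m) m
    rw [← hB, hB0, Polynomial.coeff_zero] at this
    exact (mul_eq_zero.1 this.symm).resolve_right (hc m)
  have hl : ∀ d, a (Sum.inl d) = 0 := by
    intro d
    have := coeff_sum (fun d : Fin k => a (Sum.inl d) * circleMoment d) d
    simp only [hr, map_zero, zero_mul, Finset.sum_const_zero, mul_zero, add_zero] at hP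
    rw [← hP, hP0, Polynomial.coeff_zero] at this
    exact (mul_eq_zero.1 this.symm).resolve_right (circleMoment_ne_zero d)
  funext i
  rcases i with d | m
  · exact hl d
  · exact hr m

theorem le_Z (n : ℕ) : ((n + (n + 1) / 2 : ℕ) : ℕ∞) ≤ Z n := by
  set N := n + (n + 1) / 2 with hN
  -- Any `N` distinct points of `(0, 1)` would serve.
  set s : Fin N → ℝ := fun j => ((j : ℝ) + 1) / (N + 1) with hs_def
  have hs : ∀ j, s j ∈ Ioo (0 : ℝ) 1 := by
    intro j
    have hj : (j : ℝ) < N := by exact_mod_cast j.2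
    exact ⟨by positivity, (div_lt_one (by positivity)).2 (by linarith)⟩
  have hsinj : Function.Injective fun j => 1 - s j ^ 2 := by
    intro i j hij
    have h1 : s i ^ 2 = s j ^ 2 := by simpa using hij
    have h2 := (pow_left_inj₀ (hs i).1.le (hs j).1.le two_ne_zero).1 h1
    have h3 : (N : ℝ) + 1 ≠ 0 := by positivity
    simp only [hs_def] at h2
    rw [div_left_inj' h3, add_left_inj, Nat.cast_inj] at h2
    exact Fin.ext h2
  -- There are `N + 1` vectors of values in a space of dimension `N`.
  have hdep : ¬ LinearIndependent ℝ
      (fun (i : Fin (n + 1) ⊕ Fin ((n + 1) / 2)) (j : Fin N) => basicMelnikov i (s j)) := by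
    intro hli
    have := hli.fintype_card_le_finrank
    simp at this
    omega
  obtain ⟨a, ha, i, hi⟩ := Fintype.not_linearIndependent_iff.1 hdep
  have hzero : ∀ j, melnikov (powerPerturbation a) (1 - s j ^ 2) = 0 := by
    intro j
    rw [melnikov_powerPerturbation a (hs j)]
    simpa using congrFun ha j
  have hadm : powerPerturbation a ∈ admissible n := by
    refine ⟨degreeLE_powerPerturbation n a, ?_⟩
    by_contra! hcon
    have ha0 : a = 0 := eq_zero_of_sum_basicMelnikov_eq_zero fun t ht => by
      rw [← melnikov_powerPerturbation a ht]
      exact hcon _ ⟨by nlinarith [ht.1, ht.2], by nlinarith [ht.1, ht.2]⟩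
    exact hi (by simp [ha0])
  refine le_trans ?_ (le_iSup₂_of_le _ hadm le_rfl)
  have hsub : Set.range (fun j => 1 - s j ^ 2) ⊆
      {h ∈ Ioo (0 : ℝ) 1 | melnikov (powerPerturbation a) h = 0} := by
    rintro _ ⟨j, rfl⟩
    have h1 := hs j
    exact ⟨⟨by nlinarith [h1.1, h1.2], by nlinarith [h1.1, h1.2]⟩, hzero j⟩
  refine le_trans ?_ (Set.encard_le_encard hsub)
  rw [← Set.image_univ, hsinj.encard_image, Set.encard_univ]
  simp

end PiecewiseMelnikov

end

theorem theorem1p3 (n : ℕ) (hn : 5 ≤ n) :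
    (((n + (n + 1) / 2 : ℕ) : ℕ∞) ≤ PiecewiseMelnikov.Z n ∧
      PiecewiseMelnikov.Z n ≤ ((2 * n + (n + 1) / 2 : ℕ) : ℕ∞)) ∧
    (((n + (n + 1) / 2 : ℕ) : ℕ∞) ≤ PiecewiseMelnikov.ZMult n ∧
      PiecewiseMelnikov.ZMult n ≤ ((2 * n + (n + 1) / 2 : ℕ) : ℕ∞)) := by
  have hupper := PiecewiseMelnikov.ZMult_le (n := n) (by omega)
  have hlower := PiecewiseMelnikov.le_Z n
  have hle := PiecewiseMelnikov.Z_le_ZMult n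
  exact ⟨⟨hlower, hle.trans hupper⟩, hlower.trans hle, hupper⟩
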